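/- Let $k\ge 1$ and $n\ge 1$ be integers and let $V=\{x\in\mathbb R^n : x_1+\dots+x_n=0\}$. For $1\le j<i\le n$ and $l\in\mathbb Z$ put $H_{ij}^l=\{x\in V : x_i-x_j=l\}$. The $k$-Shi arrangement is the set of hyperplanes $\{H_{ij}^l : 1\le j<i\le n,\ -k<l\le k\}$, and its regions are the connected components of the complement in $V$ of the union of these hyperplanes. Let $A_0=\{x\in V : x_1<x_2<\dots<x_n<x_1+1\}$ be the fundamental alcove. The Pak–Stanley label of a region $R$ is the function $\lambda_R:\{1,\dots,n\}\to\mathbb Z_{\ge 0}$ given by $$\lambda_R(a)=\#\{H_{ij}^l\in\mathcal H_R : l>0,\ i=a\}+\#\{H_{ij}^l\in\mathcal H_R : l\le 0,\ j=a\},$$ where $\mathcal H_R$ is the set of hyperplanes of the $k$-Shi arrangement that separate $R$ from $A_0$. A function $f:\{1,\dots,n\}\to\mathbb Z_{\ge 0}$ is a $k$-parking function if every non-empty subset $I\subseteq\{1,\dots,n\}$ contains some $i$ with $f(i)\le k(n-\#I)$. Then $R\mapsto\lambda_R$ is a bijection from the set of regions of the $k$-Shi arrangement onto the set of $k$-parking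 functions, and both of these sets have exactly $(kn+1)^{n-1}$ elements. -/

import Mathlib

namespace PakStanley

/-- The space `V = {x₁ + ⋯ + xₙ = 0}` inside `ℝⁿ`; the coordinates are indexed by `Fin n`. -/
def V (n : ℕ) : Set (Fin n → ℝ) :=
  {x | ∑ i, x i = 0}

/-- The hyperplane `H_{ij}^a = {x_i - x_j = a}` of `V`. -/
def hyperplane (n : ℕ) (i j : Fin n) (a : ℝ) : Set (Fin n → ℝ) :=
  {x | x ∈ V n ∧ x i - x j = a}

/-- The index set of the `k`-Shi arrangement: triples `(i, j, l)` with `j < i` and `-k < l ≤ k`,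
the triple `(i, j, l)` standing for the hyperplane `H_{ij}^l`.
Different triples give different hyperplanes. -/
def shiIndex (k n : ℕ) : Set (Fin n × Fin n × ℤ) :=
  {p | p.2.1 < p.1 ∧ -(k : ℤ) < p.2.2 ∧ p.2.2 ≤ (k : ℤ)}

/-- The `k`-Shi arrangement is finite, so the cardinalities in `label` are honest ones. -/
theorem shiIndex_finite (k n : ℕ) : (shiIndex k n).Finite := by
  refine Set.Finite.subset
    ((Set.finite_univ (α := Fin n)).prod
      ((Set.finite_univ (α := Fin n)).prod (Set.finite_Ioc (-(k : ℤ)) (k : ℤ)))) ?_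
  rintro ⟨i, j, l⟩ h
  exact ⟨trivial, trivial, h.2⟩

/-- The complement in `V` of the union of the hyperplanes of the `k`-Shi arrangement. -/
def shiComplement (k n : ℕ) : Set (Fin n → ℝ) :=
  V n \ ⋃ p ∈ shiIndex k n, hyperplane n p.1 p.2.1 (p.2.2 : ℝ)

/-- The regions of the `k`-Shi arrangement: the connected components of the complement. -/
def regions (k n : ℕ) : Set (Set (Fin n → ℝ)) :=
  {R | ∃ x ∈ shiComplement k n, R = connectedComponentIn (shiComplement k n) x}

/-- The fundamental alcove `x₁ < x₂ < ⋯ < xₙ < x₁ + 1` in `V`. -/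
def fundamentalAlcove (n : ℕ) : Set (Fin n → ℝ) :=
  {x | x ∈ V n ∧ ∀ i j : Fin n, i < j → x i < x j ∧ x j < x i + 1}

/-- The hyperplane `H_{ij}^a` separates `A` from `B`: they lie strictly on opposite sides. -/
def Separates {n : ℕ} (i j : Fin n) (a : ℝ) (A B : Set (Fin n → ℝ)) : Prop :=
  ((∀ x ∈ A, x i - x j < a) ∧ ∀ y ∈ B, a < y i - y j) ∨
    ((∀ x ∈ A, a < x i - x j) ∧ ∀ y ∈ B, y i - y j < a)

/-- The hyperplanes of the `k`-Shi arrangement that separate `R` from the fundamental alcove. -/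
def separating (k n : ℕ) (R : Set (Fin n → ℝ)) : Set (Fin n × Fin n × ℤ) :=
  {p | p ∈ shiIndex k n ∧ Separates p.1 p.2.1 (p.2.2 : ℝ) R (fundamentalAlcove n)}

/-- The Pak–Stanley label `λ_R` of a region `R`: its value at `a` is the number of separating
hyperplanes `H_{ij}^l` with `l > 0` and `i = a`, plus the number of those with `l ≤ 0` and
`j = a`. -/
noncomputable def label (k n : ℕ) (R : Set (Fin n → ℝ)) (a : Fin n) : ℕ :=
  {p | p ∈ separating k n R ∧ 0 < p.2.2 ∧ p.1 = a}.ncard +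
    {p | p ∈ separating k n R ∧ p.2.2 ≤ 0 ∧ p.2.1 = a}.ncard

/-- The `k`-parking functions: every non-empty `I` contains some `i` with `f i ≤ k (n - #I)`.
The subtraction does not truncate, as `#I ≤ n`. -/
def parkingFunctions (k n : ℕ) : Set (Fin n → ℕ) :=
  {f | ∀ I : Finset (Fin n), I.Nonempty → ∃ i ∈ I, f i ≤ k * (n - I.card)}

end PakStanley

/-!
Indexing coordinates from `0`, a point `x` is extended to all integers by
`x_{b + l n} = x_b + l` (`lift`). The hyperplanes `H_{ij}^l` of the `k`-Shi arrangement are then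
exactly the comparisons of `x_a` with `x_c` for `a < c ≤ a + k n` (the `window` of `a`) and `c` not
congruent to `a` modulo `n`, up to simultaneous translation of `a` and `c` by `n`, and the
label of the region of `x` is
`a ↦ #{c in the window of a : x_c < x_a}` (`belowCount`, `label_connectedComponentIn`). A region
is a sign pattern: it is convex, and no sign changes on a connected subset of the complement.

*Labels are parking functions*: in a non-empty `I`, the index with the least coordinate sees only
indices outside `I` below it, and each of those at most `k` times
(`belowCount_mem_parkingFunctions`).

*Injectivity* (`lift_lt_iff_of_belowCount_eq`): let `y` and `z` be points with the same label, and
let `x ≤ y` be a point of the closure of the region of `z` at the least distance `D` from `y`. At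
an index where `y - x` equals `0` or `D`, the entries below it in its window at `y` and at `z` are
contained in one another, and being equally many, they agree. Suppose `D > 0`. Start from the
indices with `y - x = D` and follow the equalities `x_c = x_e` that are strict inequalities
`z_c < z_e`; these are the constraints that prevent raising `x_c` alone. By the agreement just
mentioned such a path leaves the starting set by a step down in the index, and a step down
followed by a step up can be contracted to one step, so all paths can be taken to go down
(`DownReach.tight`). By the agreement at the other end they never arrive at an index with
`y - x = 0` (`DownReach.lift_lt`). Hence all the indices reached can be raised a little
(`exists_dist_lt`), which contradicts the choice of `x`. So `x = y`, and `y` and `z` lie in the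
same region.

*Surjectivity* (`exists_generic_belowCount_eq`): for a parking function `f`, consider the integer
points `0 ≤ z ≤ k f` at which the number of strictly smaller entries in each window is at most
`f`. At one with the largest coordinate sum, the number of weakly smaller entries is at least `f`,
since otherwise a coordinate could be raised; the bound `k f` is not an obstacle because of the
parking condition (`exists_int_point`). The ties of `z` are then broken by inserting the tied
indices from the largest to the smallest, each at the place that `f` prescribes
(`exists_injOn_card_filter`).

*Counting* (`ncard_parkingFunctions`): by the cycle lemma, each of the `(k n + 1) ^ n` functions
to `ℤ/(k n + 1)` has exactly one translate that is a parking function.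
-/

namespace PakStanley

/-! ### Affine extension of a point -/

section Affine

/-- The integers `c` with `a < c ≤ a + k n`: the comparisons of `lift x a` with the
`lift x c` for such `c` are the ones recorded by the `k`-Shi arrangement. -/
noncomputable def window (k n : ℕ) (a : ℤ) : Finset ℤ :=
  Finset.Ioc a (a + k * n)

theorem mem_window {k n : ℕ} {a c : ℤ} : c ∈ window k n a ↔ a < c ∧ c ≤ a + k * n := by
  simp [window]

variable {n : ℕ} [NeZero n]

/-- The residue of an integer modulo `n`, as an index of a coordinate. -/
def residue (n : ℕ) [NeZero n] (c : ℤ) : Fin n :=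
  ⟨(c % n).toNat, by
    have h0 : (n : ℤ) ≠ 0 := by exact_mod_cast NeZero.ne n
    have h1 := Int.emod_nonneg c h0
    have h2 := Int.emod_lt_of_pos c (by have := NeZero.pos n; omega : (0 : ℤ) < n)
    omega⟩

theorem coe_residue (c : ℤ) : ((residue n c : ℕ) : ℤ) = c % n := by
  have h0 : (n : ℤ) ≠ 0 := by exact_mod_cast NeZero.ne n
  exact Int.toNat_of_nonneg (Int.emod_nonneg c h0)

theorem residue_add_mul_ediv (c : ℤ) : ((residue n c : ℕ) : ℤ) + n * (c / n) = c := by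
  rw [coe_residue]; exact Int.emod_add_mul_ediv c n

theorem residue_add_mul (c q : ℤ) : residue n (c + n * q) = residue n c := by
  apply Fin.ext
  zify
  rw [coe_residue, coe_residue, Int.add_mul_emod_self_left]

theorem residue_coe (i : Fin n) : residue n ((i : ℕ) : ℤ) = i := by
  apply Fin.ext
  zify
  rw [coe_residue]
  exact Int.emod_eq_of_lt (by omega) (by exact_mod_cast i.2)

theorem residue_coe_add_mul (i : Fin n) (q : ℤ) : residue n ((i : ℕ) + n * q) = i := by
  rw [residue_add_mul, residue_coe]

variable {A : Type*} [Ring A]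

/-- The affine extension of `x` to all integers: the coordinates are indexed from `0`, and
`lift x (c + n) = lift x c + 1`. -/
def lift (x : Fin n → A) (c : ℤ) : A :=
  x (residue n c) + ((c / n : ℤ) : A)

theorem lift_add_mul (x : Fin n → A) (c q : ℤ) : lift x (c + n * q) = lift x c + q := by
  have h0 : (n : ℤ) ≠ 0 := by exact_mod_cast NeZero.ne n
  rw [lift, lift, residue_add_mul, Int.add_mul_ediv_left _ _ h0]
  push_cast
  rw [add_assoc]

theorem lift_coe (x : Fin n → A) (i : Fin n) : lift x ((i : ℕ) : ℤ) = x i := by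
  rw [lift, residue_coe, Int.ediv_eq_zero_of_lt (by omega) (by exact_mod_cast i.2)]
  simp

theorem lift_coe_add_mul (x : Fin n → A) (i : Fin n) (q : ℤ) :
    lift x ((i : ℕ) + n * q) = x i + q := by
  rw [lift_add_mul, lift_coe]

theorem card_window_filter_residue_eq (k : ℕ) (a : ℤ) (b : Fin n) :
    ((window k n a).filter fun c => residue n c = b).card = k := by
  have hn : (0 : ℤ) < n := by have := NeZero.pos n; omega
  have h : ∀ c : ℤ, residue n c = b ↔ c ≡ (b : ℕ) [ZMOD n] := by
    intro c
    rw [Fin.ext_iff, ← Int.natCast_inj, coe_residue, Int.ModEq,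
      Int.emod_eq_of_lt (a := ((b : ℕ) : ℤ)) (by omega) (by exact_mod_cast b.2)]
  have h2 := Int.Ioc_filter_modEq_card a (a + k * n) hn (b : ℕ)
  simp only [window, h]
  zify
  rw [h2]
  have : (((a + k * n : ℤ) - ((b : ℕ) : ℤ) : ℤ) / ((n : ℤ) : ℚ) : ℚ)
      = (((a : ℤ) - ((b : ℕ) : ℤ) : ℤ) / ((n : ℤ) : ℚ) : ℚ) + (k : ℤ) := by
    have : (n : ℚ) ≠ 0 := by exact_mod_cast NeZero.ne n
    push_cast
    field_simp
    ring
  push_cast at this ⊢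
  rw [this]
  have h3 := Int.floor_add_intCast (((a : ℚ) - (b : ℕ)) / (n : ℚ)) (k : ℤ)
  push_cast at h3
  rw [h3]
  simp

theorem card_window_filter_residue_mem (k : ℕ) (a : ℤ) (S : Finset (Fin n)) :
    ((window k n a).filter fun c => residue n c ∈ S).card = k * S.card := by
  rw [Finset.card_eq_sum_card_fiberwise (f := residue n) (t := S)]
  · rw [mul_comm, ← smul_eq_mul, ← Finset.sum_const]
    refine Finset.sum_congr rfl fun b hb => ?_
    rw [Finset.filter_filter]
    refine Eq.trans ?_ (card_window_filter_residue_eq k a b)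
    congr 1
    ext c
    simp only [Finset.mem_filter]
    constructor
    · rintro ⟨h, -, h'⟩; exact ⟨h, h'⟩
    · rintro ⟨h, h'⟩; exact ⟨h, h' ▸ hb, h'⟩
  · intro c hc
    simpa using (Finset.mem_filter.1 hc).2

variable [LinearOrder A] [IsStrictOrderedRing A]

/-- The number of `c` in the window of `a` at which the affine extension of `x` is smaller than
at `a`. For `x` in a region, these are the values of the Pak–Stanley label. -/
noncomputable def belowCount (k : ℕ) (x : Fin n → A) (a : ℤ) : ℕ :=
  ((window k n a).filter fun c => lift x c < lift x a).card

theorem belowCount_add_mul (k : ℕ) (x : Fin n → A) (a q : ℤ) :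
    belowCount k x (a + n * q) = belowCount k x a := by
  symm
  refine Finset.card_bij (fun c _ => c + n * q) ?_ ?_ ?_
  · intro c hc
    simp only [Finset.mem_filter, mem_window, lift_add_mul] at hc ⊢
    refine ⟨⟨by linarith, by linarith⟩, by simpa using hc.2⟩
  · intro c _ d _ h
    simpa using h
  · intro c hc
    refine ⟨c + n * (-q), ?_, by ring⟩
    simp only [Finset.mem_filter, mem_window, lift_add_mul] at hc ⊢
    refine ⟨⟨by linarith, by linarith⟩, ?_⟩
    have := hc.2
    push_cast
    rw [← sub_eq_add_neg]
    exact sub_lt_iff_lt_add.2 this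

theorem belowCount_residue (k : ℕ) (x : Fin n → A) (a : ℤ) :
    belowCount k x (residue n a : ℕ) = belowCount k x a := by
  conv_rhs => rw [← residue_add_mul_ediv (n := n) a]
  rw [belowCount_add_mul]

end Affine

/-! ### A point is determined, up to its region, by its label -/

section Injectivity

variable {n : ℕ} [NeZero n]

/-- `x` lies on no hyperplane of the `k`-Shi arrangement, in terms of its affine extension. -/
def Generic (k : ℕ) (x : Fin n → ℝ) : Prop :=
  ∀ a : ℤ, ∀ c ∈ window k n a, lift x a ≠ lift x c

/-- `x` satisfies the weak form of every inequality that holds at `z`: it lies in the closure of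
the region of `z`. -/
def WeaklyOrderedAs (k : ℕ) (z x : Fin n → ℝ) : Prop :=
  ∀ a c : ℤ, (c ∈ window k n a ∨ a ∈ window k n c) → lift z a < lift z c → lift x a ≤ lift x c

/-- Two sets of smaller entries in the window of `a` that are equally large agree once one of them
is contained in the other. -/
theorem lt_iff_lt_of_belowCount_eq {k : ℕ} {y z : Fin n → ℝ} {a : ℤ}
    (h : belowCount k y a = belowCount k z a)
    (hsub : ∀ c ∈ window k n a, lift y c < lift y a → lift z c < lift z a) {c : ℤ}
    (hc : c ∈ window k n a) : lift y c < lift y a ↔ lift z c < lift z a := by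
  have hss : ((window k n a).filter fun c => lift y c < lift y a) ⊆
      (window k n a).filter fun c => lift z c < lift z a := by
    intro c hc
    simp only [Finset.mem_filter] at hc ⊢
    exact ⟨hc.1, hsub c hc.1 hc.2⟩
  have heq := Finset.eq_of_subset_of_card_le hss h.ge
  have := congrArg (fun s => c ∈ s) heq
  simpa [hc] using this

theorem lift_le_of_le {x y : Fin n → ℝ} (h : x ≤ y) (c : ℤ) : lift x c ≤ lift y c := by
  unfold lift; linarith [h (residue n c)]

theorem lift_sub_lift (x y : Fin n → ℝ) (c : ℤ) :
    lift y c - lift x c = y (residue n c) - x (residue n c) := by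
  unfold lift; ring

/-- At a place where `x ≤ y` is an equality, `y` and the region `z` whose closure contains `x`
agree on all comparisons in the window. -/
theorem lt_iff_lt_of_lift_eq {k : ℕ} {x y z : Fin n → ℝ} (hz : Generic k z)
    (hx : WeaklyOrderedAs k z x) {a : ℤ} (h : belowCount k y a = belowCount k z a)
    (hxy : ∀ c, lift x c ≤ lift y c) (ha : lift x a = lift y a) {c : ℤ}
    (hc : c ∈ window k n a) : lift y c < lift y a ↔ lift z c < lift z a := by
  refine lt_iff_lt_of_belowCount_eq h (fun c hc hlt => ?_) hc
  by_contra hcon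
  have h1 : lift z a < lift z c := lt_of_le_of_ne (not_lt.1 hcon) (hz a c hc)
  have h2 := hx a c (Or.inl hc) h1
  linarith [hxy c]

/-- At a place where `y - x` is as large as possible, `y` and the region `z` whose closure
contains `x` agree on all comparisons in the window. -/
theorem lt_iff_lt_of_lift_eq_add {k : ℕ} {x y z : Fin n → ℝ} {D : ℝ} (hy : Generic k y)
    (hx : WeaklyOrderedAs k z x) {a : ℤ} (h : belowCount k y a = belowCount k z a)
    (hxy : ∀ c, lift y c ≤ lift x c + D) (ha : lift y a = lift x a + D) {c : ℤ}
    (hc : c ∈ window k n a) : lift y c < lift y a ↔ lift z c < lift z a := by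
  refine (lt_iff_lt_of_belowCount_eq h.symm (fun c hc hlt => ?_) hc).symm
  have h2 := hx c a (Or.inr hc) hlt
  exact lt_of_le_of_ne (by linarith [hxy c]) (hy a c hc).symm

/-- The integers that are reached from those with `y - x = D` by going down, in steps shorter than
the window, along equalities of `x` that are strict inequalities at `z`. -/
inductive DownReach (k : ℕ) (x y z : Fin n → ℝ) (D : ℝ) : ℤ → Prop
  | base {c : ℤ} (h : lift y c = lift x c + D) : DownReach k x y z D c
  | step {c e : ℤ} (hc : DownReach k x y z D c) (he : c ∈ window k n e)
      (hx : lift x c = lift x e) (hz : lift z c < lift z e) : DownReach k x y z D e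

theorem DownReach.add_mul {k : ℕ} {x y z : Fin n → ℝ} {D : ℝ} {c : ℤ}
    (h : DownReach k x y z D c) (q : ℤ) : DownReach k x y z D (c + n * q) := by
  induction h with
  | base h => exact .base (by rw [lift_add_mul, lift_add_mul, h]; ring)
  | @step c e _ he hx hz ih =>
    refine .step ih ?_ (by rw [lift_add_mul, lift_add_mul, hx])
      (by rw [lift_add_mul, lift_add_mul]; linarith)
    rw [mem_window] at he ⊢
    constructor <;> linarith

theorem downReach_residue {k : ℕ} {x y z : Fin n → ℝ} {D : ℝ} {c : ℤ} :
    DownReach k x y z D (residue n c : ℕ) ↔ DownReach k x y z D c := by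
  constructor
  · intro h
    have := h.add_mul (c / n)
    rwa [residue_add_mul_ediv] at this
  · intro h
    have := h.add_mul (-(c / n))
    have h2 := residue_add_mul_ediv (n := n) c
    rwa [show c + n * (-(c / n)) = ((residue n c : ℕ) : ℤ) by linarith] at this

/-- The set of `DownReach` is also closed under upward steps: a step down from `q` to `p` followed
by a step up to `e` is a single step from `q` to `e`, as both `q` and `e` lie in the window
of `p`. -/
theorem DownReach.tight {k : ℕ} {x y z : Fin n → ℝ} {D : ℝ} (hy : Generic k y)
    (hx : WeaklyOrderedAs k z x) (h : ∀ a, belowCount k y a = belowCount k z a)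
    (hxy : ∀ c, lift y c ≤ lift x c + D) {p : ℤ} (hp : DownReach k x y z D p) :
    ∀ e : ℤ, (e ∈ window k n p ∨ p ∈ window k n e) → lift x p = lift x e →
      lift z p < lift z e → DownReach k x y z D e := by
  induction hp with
  | @base p hp =>
    rintro e (he | he) hxe hze
    · -- `e` is not below `p` at `z`, hence not at `y`, so that `y - x = D` at `e` too.
      have h1 := (lt_iff_lt_of_lift_eq_add hy hx (h p) hxy hp he).not.2 hze.le.not_gt
      exact .base (le_antisymm (hxy e) (by linarith [not_lt.1 h1]))
    · exact .step (.base hp) he hxe hze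
  | @step q p hq hqp hxq hzq ih =>
    rintro e (he | he) hxe hze
    · have hne : q ≠ e := by rintro rfl; exact lt_asymm hzq hze
      refine ih e ?_ (hxq.trans hxe) (hzq.trans hze)
      rw [mem_window] at hqp he
      rw [mem_window, mem_window]
      omega
    · exact .step (.step hq hqp hxq hzq) he hxe hze

/-- No index with `x = y` is reached: the last step down would come from an entry smaller at `z`,
and hence smaller at `y`, while `x ≤ y` and the equality of the two entries of `x` say the opposite. -/
theorem DownReach.lift_lt {k : ℕ} {x y z : Fin n → ℝ} {D : ℝ} (hD : 0 < D) (hz : Generic k z)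
    (hx : WeaklyOrderedAs k z x) (h : ∀ a, belowCount k y a = belowCount k z a)
    (hxy : ∀ c, lift x c ≤ lift y c) {p : ℤ} (hp : DownReach k x y z D p) :
    lift x p < lift y p := by
  induction hp with
  | base h => linarith
  | @step c e _ he hxc hzc _ =>
    refine lt_of_le_of_ne (hxy e) fun hcon => ?_
    have := (lt_iff_lt_of_lift_eq hz hx (h e) hxy hcon he).2 hzc
    linarith [hxy c]

open Filter Topology in
/-- If `x ≤ y` is not an equality, it can be moved closer to `y` within the closure of the region
of `z`, by raising the coordinates in `DownReach`. -/
theorem exists_dist_lt {k : ℕ} {x y z : Fin n → ℝ} (hy : Generic k y) (hz : Generic k z)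
    (h : ∀ a, belowCount k y a = belowCount k z a) (hx : WeaklyOrderedAs k z x) (hxy : x ≤ y)
    (hne : x ≠ y) : ∃ x', WeaklyOrderedAs k z x' ∧ x' ≤ y ∧ dist y x' < dist y x := by
  classical
  set D := dist y x with hDdef
  have hD : 0 < D := dist_pos.2 hne.symm
  have hle : ∀ i, y i - x i ≤ D := fun i => (le_abs_self _).trans (dist_le_pi_dist y x i)
  have hxyl := lift_le_of_le hxy
  have hxyD : ∀ c, lift y c ≤ lift x c + D := fun c => by
    linarith [lift_sub_lift x y c, hle (residue n c)]
  have hlt : ∀ i : Fin n, DownReach k x y z D (i : ℕ) → x i < y i := fun i hi => by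
    have := hi.lift_lt hD hz hx h hxyl
    rwa [lift_coe, lift_coe] at this
  have hbase : ∀ i : Fin n, ¬ DownReach k x y z D (i : ℕ) → y i - x i < D := fun i hi =>
    lt_of_le_of_ne (hle i) fun hcon => hi (.base (by rw [lift_coe, lift_coe]; linarith))
  let u : Fin n → ℝ := fun i => if DownReach k x y z D (i : ℕ) then 1 else 0
  have hu : ∀ ε c, lift (fun i => x i + ε * u i) c =
      lift x c + ε * if DownReach k x y z D c then 1 else 0 := fun ε c => by
    simp only [lift, u, downReach_residue]; ring
  have hsmall : ∀ δ : ℝ, 0 < δ → ∀ᶠ ε in 𝓝[>] (0 : ℝ), ε < δ := fun δ hδ =>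
    mem_nhdsWithin_of_mem_nhds (Iio_mem_nhds hδ)
  have hpos : ∀ᶠ ε in 𝓝[>] (0 : ℝ), 0 < ε := self_mem_nhdsWithin
  have e1 : ∀ᶠ ε in 𝓝[>] (0 : ℝ), ∀ i, x i < y i → ε < y i - x i :=
    eventually_all.2 fun i => by
      by_cases hi : x i < y i
      · filter_upwards [hsmall _ (sub_pos.2 hi)] with ε h1 _ using h1
      · exact Eventually.of_forall fun _ h1 => absurd h1 hi
  have e2 : ∀ᶠ ε in 𝓝[>] (0 : ℝ), ∀ i : Fin n,
      ∀ c ∈ Finset.Icc ((i : ℤ) - k * n) (i + k * n), lift x i < lift x c →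
        ε < lift x c - lift x i :=
    eventually_all.2 fun i => (eventually_all_finset _).2 fun c _ => by
      by_cases hi : lift x i < lift x c
      · filter_upwards [hsmall _ (sub_pos.2 hi)] with ε h1 _ using h1
      · exact Eventually.of_forall fun _ h1 => absurd h1 hi
  obtain ⟨ε, h0, hεD, h1, h2⟩ := (hpos.and ((hsmall D hD).and (e1.and e2))).exists
  refine ⟨fun i => x i + ε * u i, ?_, ?_, ?_⟩
  · intro a c hac hzac
    have hxac := hx a c hac hzac
    rw [hu, hu]
    by_cases ha : DownReach k x y z D a
    · rcases hxac.eq_or_lt with heq | hlt'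
      · have hc := ha.tight hy hx h hxyD c hac heq hzac
        simp [ha, hc, hxac]
      · have h3 := h2 (residue n a) (c + n * (-(a / n))) (by
          have := residue_add_mul_ediv (n := n) a
          rw [mem_window, mem_window] at hac
          rw [Finset.mem_Icc]
          constructor <;> rcases hac with hac | hac <;> nlinarith)
        have h4 : lift x a = lift x ((residue n a : ℕ) : ℤ) + ((a / n : ℤ) : ℝ) := by
          rw [lift_coe, lift]
        rw [lift_add_mul] at h3
        push_cast at h3
        have h5 := h3 (by linarith)
        rw [if_pos ha]
        split_ifs <;> linarith
    · rw [if_neg ha]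
      split_ifs <;> linarith
  · intro i
    by_cases hi : DownReach k x y z D (i : ℕ)
    · simp only [u, if_pos hi]; linarith [h1 i (hlt i hi)]
    · simp only [u, if_neg hi]; linarith [hxy i]
  · rw [dist_pi_lt_iff hD]
    intro i
    by_cases hi : DownReach k x y z D (i : ℕ)
    · simp only [u, if_pos hi, Real.dist_eq, abs_lt]
      constructor <;> linarith [h1 i (hlt i hi), hle i]
    · simp only [u, if_neg hi, Real.dist_eq, abs_lt]
      constructor <;> linarith [hbase i hi, hxy i]

theorem continuous_lift (c : ℤ) : Continuous fun x : Fin n → ℝ => lift x c := by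
  unfold lift; fun_prop

/-- Generic points with the same label lie in the same region: a point of the closure of the region
of `z` that is closest to `y` among those below `y` is `y` itself. -/
theorem lift_lt_iff_of_belowCount_eq {k : ℕ} {y z : Fin n → ℝ} (hy : Generic k y)
    (hz : Generic k z) (h : ∀ a, belowCount k y a = belowCount k z a) {a c : ℤ}
    (hac : c ∈ window k n a) : lift y c < lift y a ↔ lift z c < lift z a := by
  let K : Set (Fin n → ℝ) := {x | WeaklyOrderedAs k z x ∧ x ≤ y}
  have hK : IsClosed K := by
    refine IsClosed.inter ?_ isClosed_Iic
    have heq : {x : Fin n → ℝ | WeaklyOrderedAs k z x} = ⋂ (a : ℤ) (c : ℤ)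
        (_ : c ∈ window k n a ∨ a ∈ window k n c) (_ : lift z a < lift z c),
        {x | lift x a ≤ lift x c} := by
      ext x
      simp only [Set.mem_iInter, Set.mem_ofPred_eq, WeaklyOrderedAs]
    refine (congrArg IsClosed heq).mpr ?_
    exact isClosed_iInter fun a => isClosed_iInter fun c => isClosed_iInter fun _ =>
      isClosed_iInter fun _ => isClosed_le (continuous_lift a) (continuous_lift c)
  have hne : K.Nonempty := by
    -- a translate of `z` that lies below `y`
    obtain ⟨M, hM⟩ := (Set.finite_range fun i => z i - y i).bddAbove
    have hM' : ∀ i, z i - y i ≤ M := fun i => hM ⟨i, rfl⟩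
    refine ⟨fun i => z i - M, fun a c _ hlt => ?_, fun i => by
      show z i - M ≤ y i
      linarith [hM' i]⟩
    unfold lift at hlt ⊢
    linarith
  obtain ⟨x, hxK, hmin⟩ := hK.exists_infDist_eq_dist hne y
  have hxy : x = y := by
    by_contra hcon
    obtain ⟨x', hx', hxy', hlt⟩ := exists_dist_lt hy hz h hxK.1 hxK.2 hcon
    exact (Metric.infDist_le_dist_of_mem (show x' ∈ K from ⟨hx', hxy'⟩)).not_gt (hmin ▸ hlt)
  subst hxy
  exact lt_iff_lt_of_lift_eq hz hxK.1 (h a) (fun _ => le_rfl) rfl hac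

end Injectivity

/-! ### Parking functions as lattice paths -/

section Parking

variable {n : ℕ} {k : ℕ}

theorem parking_le {f : Fin n → ℕ} (hf : f ∈ parkingFunctions k n) (i : Fin n) :
    f i ≤ k * n := by
  obtain ⟨j, hj, h⟩ := hf {i} (Finset.singleton_nonempty i)
  rw [Finset.mem_singleton.1 hj] at h
  exact h.trans (Nat.mul_le_mul_left k (Nat.sub_le _ _))

/-- Parking functions in terms of counts: the path that takes an up step of height `k` for each
value and one down step per unit stays non-negative up to `k n`. -/
theorem mem_parkingFunctions_iff (hk : 0 < k) {f : Fin n → ℕ} :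
    f ∈ parkingFunctions k n ↔
      ∀ v ≤ k * n, v ≤ k * (Finset.univ.filter fun i => f i < v).card := by
  classical
  constructor
  · intro hf v hv
    by_contra! hcon
    have hcard := Finset.card_filter_add_card_filter_not (s := Finset.univ) (fun i => f i < v)
    rw [Finset.card_univ, Fintype.card_fin] at hcard
    have hne : (Finset.univ.filter fun i => ¬ f i < v).Nonempty := by
      refine Finset.card_pos.1 (Nat.pos_of_ne_zero fun h0 => ?_)
      have : (Finset.univ.filter fun i => f i < v).card = n := by omega
      exact (this ▸ hcon).not_ge hv
    obtain ⟨i, hi, hle⟩ := hf _ hne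
    rw [Finset.mem_filter] at hi
    have : n - (Finset.univ.filter fun i => ¬ f i < v).card
        = (Finset.univ.filter fun i => f i < v).card := by omega
    rw [this] at hle
    omega
  · intro h I hI
    by_contra! hcon
    have hIn : I.card ≤ n := by simpa using Finset.card_le_univ I
    have hpos := hI.card_pos
    have hsub : (Finset.univ.filter fun i => f i < k * (n - I.card) + 1) ⊆ Iᶜ := by
      intro i hi
      rw [Finset.mem_filter] at hi
      rw [Finset.mem_compl]
      intro hiI
      have := hcon i hiI
      omega
    have hc := Finset.card_le_card hsub
    rw [Finset.card_compl, Fintype.card_fin] at hc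
    have hle : k * (n - I.card) + 1 ≤ k * n := by
      calc k * (n - I.card) + 1 ≤ k * (n - I.card) + k := by omega
        _ = k * (n - I.card + 1) := by ring
        _ ≤ k * n := Nat.mul_le_mul_left k (by omega)
    have h1 := h _ hle
    have h2 := Nat.mul_le_mul_left k hc
    omega

end Parking

/-! ### Every parking function is a label -/

section Surjectivity

variable {n : ℕ} [NeZero n]

/-- An integer point at which `f` lies between the strict and the weak count. It is a point with
largest coordinate sum among those between `0` and `k f` whose strict counts are at most `f`. -/
theorem exists_int_point {k : ℕ} (hk : 0 < k) {f : Fin n → ℕ} (hf : f ∈ parkingFunctions k n) :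
    ∃ z : Fin n → ℤ, ∀ a : ℤ, belowCount k z a ≤ f (residue n a) ∧
      f (residue n a) ≤ ((window k n a).filter fun c => lift z c ≤ lift z a).card := by
  classical
  let y : Fin n → ℤ := fun i => k * f i
  let S := (Finset.Icc 0 y).filter fun z => ∀ i : Fin n, belowCount k z (i : ℕ) ≤ f i
  have h0 : (0 : Fin n → ℤ) ∈ S := by
    refine Finset.mem_filter.2 ⟨Finset.mem_Icc.2 ⟨le_rfl, fun i => ?_⟩, fun i => ?_⟩
    · simp only [y]; positivity
    · rw [belowCount, Finset.filter_false_of_mem]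
      · simp
      · intro c hc
        rw [mem_window] at hc
        have := Int.ediv_le_ediv (by have := NeZero.pos n; omega : (0 : ℤ) < n) hc.1.le
        simpa [lift] using this
  obtain ⟨z, hzS, hmax⟩ := S.exists_max_image (fun z => ∑ i, z i) ⟨0, h0⟩
  obtain ⟨hz, hzf⟩ := Finset.mem_filter.1 hzS
  obtain ⟨hz0, hzy⟩ := Finset.mem_Icc.1 hz
  refine ⟨z, fun a => ⟨by rw [← belowCount_residue]; exact hzf _, ?_⟩⟩
  by_contra! hcon
  set j := residue n a with hj
  -- raising the coordinate `j` by one keeps the point in `S`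
  have hlift : ∀ c, lift (z + Pi.single j 1) c = lift z c + if residue n c = j then 1 else 0 := by
    intro c
    simp only [lift, Pi.add_apply, Pi.single_apply]
    ring
  have hlt : z j < y j := by
    refine lt_of_le_of_ne (hzy j) fun heq => hcon.not_ge ?_
    have hpk := (mem_parkingFunctions_iff hk).1 hf (f j) (parking_le hf j)
    rw [← card_window_filter_residue_mem k a] at hpk
    refine hpk.trans (Finset.card_le_card fun c hc => ?_)
    simp only [Finset.mem_filter, Finset.mem_univ, true_and] at hc ⊢
    refine ⟨hc.1, ?_⟩
    rw [mem_window] at hc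
    have hn : (0 : ℤ) < n := by have := NeZero.pos n; omega
    have h1 : c / n ≤ a / n + k := by
      have := Int.ediv_le_ediv hn hc.1.2
      rwa [mul_comm, Int.add_mul_ediv_left _ _ hn.ne'] at this
    have h2 : z (residue n c) ≤ k * f (residue n c) := hzy _
    have h3 : (k : ℤ) * (f (residue n c) + 1) ≤ k * f j := by
      exact_mod_cast Nat.mul_le_mul_left k hc.2
    have h4 : z j = k * f j := heq
    simp only [lift, ← hj, h4, Int.cast_id]
    linarith
  have hmem : z + Pi.single j 1 ∈ S := by
    refine Finset.mem_filter.2 ⟨Finset.mem_Icc.2 ⟨?_, ?_⟩, ?_⟩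
    · exact hz0.trans (le_add_of_nonneg_right (Pi.single_nonneg.2 zero_le_one))
    · intro i
      by_cases hi : i = j
      · subst hi; simp; omega
      · simp [hi]; exact hzy i
    · intro i
      by_cases hi : i = j
      · rw [hi, hj, belowCount_residue, ← hj]
        refine le_trans (Finset.card_le_card ?_) hcon.le
        intro c
        simp only [Finset.mem_filter, hlift, ← hj, if_true]
        rintro ⟨h1, h2⟩
        refine ⟨h1, ?_⟩
        split_ifs at h2 <;> omega
      · refine le_trans (Finset.card_le_card ?_) (hzf i)
        intro c
        simp only [Finset.mem_filter, hlift, residue_coe, if_neg hi]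
        rintro ⟨h1, h2⟩
        refine ⟨h1, ?_⟩
        split_ifs at h2 <;> omega
  have := hmax _ hmem
  simp [Finset.sum_add_distrib] at this

/-- A real number with exactly `r` elements of `W` below it that avoids `F`. -/
theorem exists_mem_Ioo_card_filter_lt (W F : Finset ℝ) (hWF : W ⊆ F)
    (hF : ∀ s ∈ F, s ∈ Set.Ioo (0 : ℝ) 1) {r : ℕ} (hr : r ≤ W.card) :
    ∃ v ∈ Set.Ioo (0 : ℝ) 1, v ∉ F ∧ (W.filter (· < v)).card = r := by
  obtain ⟨t, ht0, ht1, ht⟩ : ∃ t : ℝ, 0 < t ∧ t ≤ 1 ∧ (W.filter (· < t)).card = r := by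
    rcases hr.eq_or_lt with rfl | hr
    · exact ⟨1, one_pos, le_rfl, by
        rw [Finset.filter_true_of_mem fun s hs => (hF s (hWF hs)).2]⟩
    · let g := W.orderEmbOfFin rfl
      have hg : g ⟨r, hr⟩ ∈ W := W.orderEmbOfFin_mem rfl _
      refine ⟨g ⟨r, hr⟩, (hF _ (hWF hg)).1, (hF _ (hWF hg)).2.le, ?_⟩
      have : W.filter (· < g ⟨r, hr⟩) = (Finset.Iio (⟨r, hr⟩ : Fin W.card)).map g.toEmbedding := by
        ext s
        simp only [Finset.mem_filter, Finset.mem_map, Finset.mem_Iio, RelEmbedding.coe_toEmbedding]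
        constructor
        · rintro ⟨hs, hlt⟩
          have : s ∈ Set.range g := by rw [Finset.range_orderEmbOfFin]; exact hs
          obtain ⟨i, rfl⟩ := this
          exact ⟨i, g.lt_iff_lt.1 hlt, rfl⟩
        · rintro ⟨i, hi, rfl⟩
          exact ⟨W.orderEmbOfFin_mem rfl _, g.lt_iff_lt.2 hi⟩
      rw [this, Finset.card_map, Fin.card_Iio]
  -- `v` is chosen just below `t`, above all elements of `F` that are smaller than `t`
  have hev : ∀ᶠ v in nhdsWithin t (Set.Iio t), 0 < v ∧ v < t ∧ ∀ s ∈ F, s < t → s < v := by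
    refine Filter.Eventually.and (mem_nhdsWithin_of_mem_nhds (Ioi_mem_nhds ht0)) <|
      Filter.Eventually.and self_mem_nhdsWithin <|
      (Filter.eventually_all_finset _).2 fun s _ => ?_
    by_cases hs : s < t
    · filter_upwards [mem_nhdsWithin_of_mem_nhds (Ioi_mem_nhds hs)] with v hv _ using hv
    · exact Filter.Eventually.of_forall fun _ h => absurd h hs
  obtain ⟨v, hv0, hvt, hv⟩ := hev.exists
  refine ⟨v, ⟨hv0, hvt.trans_le ht1⟩, fun hvF => lt_irrefl _ (hv v hvF hvt), ?_⟩
  rw [← ht]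
  congr 1
  refine Finset.filter_congr fun s hs => ⟨fun h => h.trans hvt, fun h => hv s (hWF hs) h⟩

/-- An ordering of a finite set of integers is built with prescribed numbers of earlier
elements in each window: the elements are inserted from the largest to the smallest, each
insertion leaving the counts of the larger elements unchanged. -/
theorem exists_injOn_card_filter (w : ℤ → Finset ℤ) (hw : ∀ a, ∀ c ∈ w a, a < c)
    (T : Finset ℤ) (r : ℤ → ℕ) (hr : ∀ a ∈ T, r a ≤ ((w a).filter (· ∈ T)).card) :
    ∃ σ : ℤ → ℝ, Set.InjOn σ T ∧ (∀ a ∈ T, σ a ∈ Set.Ioo (0 : ℝ) 1) ∧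
      ∀ a ∈ T, ((w a).filter fun c => c ∈ T ∧ σ c < σ a).card = r a := by
  classical
  induction T using Finset.induction_on_min with
  | empty => exact ⟨fun _ => 0, by simp⟩
  | insert a T ha ih =>
    have haT : a ∉ T := fun h => lt_irrefl _ (ha a h)
    have hwa : ∀ b ∈ insert a T, ∀ c ∈ w b, c ∈ insert a T ↔ c ∈ T := by
      intro b hb c hc
      rw [Finset.mem_insert, or_iff_right]
      rintro rfl
      have := hw b c hc
      rcases Finset.mem_insert.1 hb with rfl | hb
      · exact lt_irrefl _ this
      · exact lt_asymm this (ha b hb)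
    have hfil : ∀ b ∈ insert a T, (w b).filter (· ∈ insert a T) = (w b).filter (· ∈ T) :=
      fun b hb => Finset.filter_congr (hwa b hb)
    obtain ⟨σ, hinj, hσ, hcount⟩ := ih fun b hb => by
      rw [← hfil b (Finset.mem_insert_of_mem hb)]
      exact hr b (Finset.mem_insert_of_mem hb)
    have hra := hr a (Finset.mem_insert_self a T)
    rw [hfil a (Finset.mem_insert_self a T)] at hra
    have hinjw : Set.InjOn σ ((w a).filter (· ∈ T) : Finset ℤ) := fun b hb c hc h =>
      hinj (Finset.mem_filter.1 hb).2 (Finset.mem_filter.1 hc).2 h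
    rw [← Finset.card_image_of_injOn hinjw] at hra
    obtain ⟨v, hv, hvF, hvr⟩ := exists_mem_Ioo_card_filter_lt _ (T.image σ)
      (Finset.image_subset_image fun b hb => (Finset.mem_filter.1 hb).2)
      (fun s hs => by
        obtain ⟨b, hb, rfl⟩ := Finset.mem_image.1 hs
        exact hσ b hb) hra
    have hne : ∀ b ∈ T, b ≠ a := fun b hb h => haT (h ▸ hb)
    have hup : ∀ b ∈ T, Function.update σ a v b = σ b := fun b hb =>
      Function.update_of_ne (hne b hb) _ _
    refine ⟨Function.update σ a v, ?_, ?_, ?_⟩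
    · rw [Finset.coe_insert, Set.injOn_insert haT]
      refine ⟨fun b hb c hc h => hinj hb hc (by rwa [hup b hb, hup c hc] at h), ?_⟩
      rw [Function.update_self]
      rintro ⟨b, hb, h⟩
      rw [hup b hb] at h
      exact hvF (Finset.mem_image.2 ⟨b, hb, h⟩)
    · intro b hb
      rcases Finset.mem_insert.1 hb with rfl | hb
      · rwa [Function.update_self]
      · rw [hup b hb]; exact hσ b hb
    · intro b hb
      have hstep : ((w b).filter fun c => c ∈ insert a T ∧
          Function.update σ a v c < Function.update σ a v b) =
          (w b).filter fun c => c ∈ T ∧ σ c < Function.update σ a v b := by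
        refine Finset.filter_congr fun c hc => ?_
        rw [hwa b hb c hc]
        refine and_congr_right fun hcT => ?_
        rw [hup c hcT]
      rw [hstep]
      rcases Finset.mem_insert.1 hb with rfl | hb
      · rw [Function.update_self, ← hvr, Finset.filter_image, Finset.card_image_of_injOn,
          Finset.filter_filter]
        exact hinjw.mono (Finset.filter_subset _ _)
      · rw [hup b hb]; exact hcount b hb

/-- Every parking function counts the smaller entries in the windows of some generic point. -/
theorem exists_generic_belowCount_eq {k : ℕ} (hk : 0 < k) {f : Fin n → ℕ}
    (hf : f ∈ parkingFunctions k n) :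
    ∃ x : Fin n → ℝ, Generic k x ∧ ∀ a, belowCount k x a = f (residue n a) := by
  classical
  obtain ⟨z, hz⟩ := exists_int_point hk hf
  -- `T` is the set of the integers at which the affine extension of `z` vanishes
  let τ : ℤ → ℤ := fun c => c + n * (-lift z c)
  have hτ : ∀ c, lift z (τ c) = 0 := fun c => by
    simp only [τ]
    rw [lift_add_mul, Int.cast_id, add_neg_cancel]
  have hττ : ∀ c, τ c = τ (residue n c : ℕ) := fun c => by
    have := residue_add_mul_ediv (n := n) c
    simp only [τ, lift_coe]
    simp only [lift, Int.cast_id]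
    linarith
  let T : Finset ℤ := Finset.univ.image fun i : Fin n => τ (i : ℕ)
  have hT : ∀ c, c ∈ T ↔ lift z c = 0 := by
    intro c
    simp only [T, Finset.mem_image, Finset.mem_univ, true_and]
    constructor
    · rintro ⟨i, rfl⟩; exact hτ _
    · intro h
      refine ⟨residue n c, ?_⟩
      rw [← hττ]
      simp [τ, h]
  have hsplit : ∀ a ∈ T, ((window k n a).filter fun c => lift z c ≤ lift z a).card =
      belowCount k z a + ((window k n a).filter (· ∈ T)).card := by
    intro a ha
    rw [hT] at ha
    rw [belowCount, ← Finset.card_union_of_disjoint, ← Finset.filter_or]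
    · congr 1
      refine Finset.filter_congr fun c _ => ?_
      rw [hT, ha]
      omega
    · rw [Finset.disjoint_filter]
      intro c _ h1 h2
      rw [hT] at h2
      omega
  obtain ⟨σ, hinj, hσ, hcount⟩ := exists_injOn_card_filter (window k n)
    (fun a c hc => (mem_window.1 hc).1) T (fun a => f (residue n a) - belowCount k z a)
    (fun a ha => by have := hsplit a ha; have := (hz a).2; omega)
  have hτT : ∀ c, τ c ∈ T := fun c => (hT _).2 (hτ c)
  let x : Fin n → ℝ := fun i => z i + σ (τ (i : ℕ))
  have hx : ∀ c, lift x c = (lift z c : ℤ) + σ (τ c) := fun c => by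
    rw [hττ c]
    simp only [lift, x]
    push_cast
    ring
  have hτeq : ∀ c, lift z c = 0 → τ c = c := fun c h => by simp [τ, h]
  have hlt : ∀ a c, lift x c < lift x a ↔
      (lift z c : ℤ) < lift z a ∨ ((lift z c : ℤ) = lift z a ∧ σ (τ c) < σ (τ a)) := by
    intro a c
    have h1 := hσ _ (hτT c)
    have h2 := hσ _ (hτT a)
    rw [hx, hx]
    rcases lt_trichotomy (lift z c) (lift z a) with h | h | h
    · have : ((lift z c : ℤ) : ℝ) + 1 ≤ (lift z a : ℤ) := by exact_mod_cast h
      simp only [h, true_or, iff_true]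
      linarith [h1.2, h2.1]
    · simp [h]
    · have : ((lift z a : ℤ) : ℝ) + 1 ≤ (lift z c : ℤ) := by exact_mod_cast h
      simp only [h.not_gt, h.ne', false_and, or_false, iff_false, not_lt]
      linarith [h1.1, h2.2]
  refine ⟨x, ?_, ?_⟩
  · intro a c hc heq
    have h1 := (hlt a c).not.1 heq.le.not_gt
    have h2 := (hlt c a).not.1 heq.ge.not_gt
    push Not at h1 h2
    have h3 : lift z c = lift z a := le_antisymm h2.1 h1.1
    have h4 := hinj (hτT c) (hτT a) (le_antisymm (h2.2 h3.symm) (h1.2 h3))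
    have := (mem_window.1 hc).1
    simp only [τ, h3] at h4
    omega
  · intro a
    have hres : residue n (τ a) = residue n a := residue_add_mul _ _
    have h1 : belowCount k x a = belowCount k x (τ a) := (belowCount_add_mul _ _ _ _).symm
    rw [h1, ← hres]
    generalize hb : τ a = b
    have hbT : b ∈ T := hb ▸ hτT a
    have hb0 := (hT b).1 hbT
    have h2 : belowCount k x b = belowCount k z b +
        ((window k n b).filter fun c => c ∈ T ∧ σ c < σ b).card := by
      rw [belowCount, belowCount, ← Finset.card_union_of_disjoint, ← Finset.filter_or]
      · congr 1
        refine Finset.filter_congr fun c _ => ?_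
        rw [hlt, hT, hb0, hτeq b hb0]
        refine or_congr_right (and_congr_right fun hc => ?_)
        rw [hτeq c hc]
      · rw [Finset.disjoint_filter]
        intro c _ h1 h2
        have := (hT c).1 h2.1
        omega
    rw [h2, hcount b hbT]
    have := (hz b).1
    omega

end Surjectivity

/-! ### The number of parking functions -/

section Count

/-- Cycle lemma: if a sequence of integers drops by exactly one over each period `m`, then exactly
one starting point in a period is such that the sequence stays at or above its starting value for
a whole period. -/
theorem existsUnique_cyclic_start {m : ℕ} (hm : 0 < m) (S : ℕ → ℤ)
    (hS : ∀ v, S (v + m) = S v - 1) :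
    ∃! c, c < m ∧ ∀ v < m, S c ≤ S (c + v) := by
  classical
  obtain ⟨c₁, hc₁, hmin⟩ := (Finset.range m).exists_min_image S ⟨0, Finset.mem_range.2 hm⟩
  have hex : ∃ c, c < m ∧ ∀ v < m, S c ≤ S v :=
    ⟨c₁, Finset.mem_range.1 hc₁, fun v hv => hmin v (Finset.mem_range.2 hv)⟩
  -- the starting point is the first minimum in the period
  obtain ⟨hc, hcmin⟩ := Nat.find_spec hex
  have hgood : ∀ v < m, S (Nat.find hex) ≤ S (Nat.find hex + v) := by
    intro v hv
    rcases lt_or_ge (Nat.find hex + v) m with h | h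
    · exact hcmin _ h
    · obtain ⟨w, hw⟩ := Nat.exists_eq_add_of_le' h
      rw [hw, hS]
      have hlt : w < Nat.find hex := by omega
      have h1 := Nat.find_min hex hlt
      push Not at h1
      obtain ⟨u, hu, hlt'⟩ := h1 (by omega)
      have := hcmin u hu
      omega
  have key : ∀ c c', c < c' → c' < m → (∀ v < m, S c ≤ S (c + v)) →
      ¬ ∀ v < m, S c' ≤ S (c' + v) := by
    intro c c' hlt hm' h h'
    have h1 := h (c' - c) (by omega)
    have h2 := h' (c + m - c') (by omega)
    rw [show c + (c' - c) = c' by omega] at h1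
    rw [show c' + (c + m - c') = c + m by omega, hS] at h2
    omega
  refine ⟨Nat.find hex, ⟨hc, hgood⟩, fun d ⟨hd, hdS⟩ => ?_⟩
  rcases lt_trichotomy d (Nat.find hex) with h | h | h
  · exact absurd hgood (key _ _ h hc hdS)
  · exact h
  · exact absurd hdS (key _ _ h hd hgood)

variable {n k : ℕ}

/-- The number of pairs of an index `i` and a `t < v` with `t` congruent to `g i`. -/
def residueCount {m : ℕ} (g : Fin n → ZMod m) (v : ℕ) : ℕ :=
  ∑ t ∈ Finset.range v, (Finset.univ.filter fun i => g i = (t : ZMod m)).card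

theorem residueCount_add {m : ℕ} [NeZero m] (g : Fin n → ZMod m) (c : ℕ) {v : ℕ} (hv : v ≤ m) :
    residueCount g (c + v) =
      residueCount g c + (Finset.univ.filter fun i => (g i - c).val < v).card := by
  classical
  rw [residueCount, Finset.sum_range_add, ← residueCount, Nat.add_left_cancel_iff,
    Finset.card_eq_sum_card_fiberwise (f := fun i => (g i - c).val) (t := Finset.range v)]
  · refine Finset.sum_congr rfl fun t ht => ?_
    rw [Finset.mem_range] at ht
    rw [Finset.filter_filter]
    congr 1
    refine Finset.filter_congr fun i _ => ?_
    rw [Nat.cast_add]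
    constructor
    · intro h
      rw [h, add_sub_cancel_left, ZMod.val_cast_of_lt (by omega)]
      exact ⟨ht, rfl⟩
    · rintro ⟨-, rfl⟩
      rw [ZMod.natCast_zmod_val, add_sub_cancel]
  · intro i hi
    simpa using (Finset.mem_filter.1 hi).2

/-- Every function to `ℤ/(kn+1)` has exactly one translate that is a parking function. -/
theorem existsUnique_sub_mem_parkingFunctions {m : ℕ} [NeZero m] (hk : 0 < k)
    (hm : m = k * n + 1) (g : Fin n → ZMod m) :
    ∃! c : ZMod m, (fun i => (g i - c).val) ∈ parkingFunctions k n := by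
  let S : ℕ → ℤ := fun v => k * residueCount g v - v
  have hcard : ∀ c : ℕ, (Finset.univ.filter fun i => (g i - c).val < m).card = n := fun c => by
    rw [Finset.filter_true_of_mem fun i _ => ZMod.val_lt _, Finset.card_univ, Fintype.card_fin]
  have hS : ∀ v, S (v + m) = S v - 1 := fun v => by
    simp only [S]
    rw [residueCount_add g v le_rfl, hcard]
    push_cast [hm]
    ring
  have hiff : ∀ c : ℕ, (fun i => (g i - c).val) ∈ parkingFunctions k n ↔
      ∀ v < m, S c ≤ S (c + v) := fun c => by
    rw [mem_parkingFunctions_iff hk]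
    have hvm : ∀ v, v < m ↔ v ≤ k * n := fun v => by omega
    simp only [hvm]
    refine forall₂_congr fun v hv => ?_
    simp only [S]
    rw [residueCount_add g c (by omega : v ≤ m)]
    zify
    constructor <;> intro h <;> linarith
  obtain ⟨c, ⟨hc, hcS⟩, huniq⟩ := existsUnique_cyclic_start (by omega : 0 < m) S hS
  refine ⟨(c : ZMod m), (hiff c).2 hcS, fun d hd => ?_⟩
  have h1 : ((d.val : ℕ) : ZMod m) = d := ZMod.natCast_zmod_val d
  rw [← h1] at hd ⊢
  rw [huniq d.val ⟨ZMod.val_lt d, (hiff _).1 hd⟩]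

theorem ncard_parkingFunctions (hk : 0 < k) (hn : 1 ≤ n) :
    (parkingFunctions k n).ncard = (k * n + 1) ^ (n - 1) := by
  classical
  let P : Finset (Fin n → ZMod (k * n + 1)) :=
    Finset.univ.filter fun g => (fun i => (g i).val) ∈ parkingFunctions k n
  have hP : (parkingFunctions k n).ncard = P.card := by
    symm
    rw [← Set.ncard_coe_finset]
    refine Set.ncard_congr (fun g _ i => (g i).val) ?_ ?_ ?_
    · intro g hg
      exact (Finset.mem_filter.1 hg).2
    · intro g h _ _ heq
      exact funext fun i => ZMod.val_injective _ (congrFun heq i)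
    · intro f hf
      have hval : (fun i => ((f i : ℕ) : ZMod (k * n + 1)).val) = f := funext fun i =>
        ZMod.val_cast_of_lt (Nat.lt_succ_of_le (parking_le hf i))
      exact ⟨fun i => (f i : ZMod (k * n + 1)),
        Finset.mem_coe.2 (Finset.mem_filter.2 ⟨Finset.mem_univ _, hval.symm ▸ hf⟩), hval⟩
  have hmul : P.card * (k * n + 1) = (k * n + 1) ^ n := by
    have h1 : (P ×ˢ (Finset.univ : Finset (ZMod (k * n + 1)))).card =
        (Finset.univ : Finset (Fin n → ZMod (k * n + 1))).card := by
      refine Finset.card_bij (fun p _ i => p.1 i + p.2) (fun _ _ => Finset.mem_univ _) ?_ ?_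
      · rintro ⟨g, c⟩ hg ⟨g', c'⟩ hg' heq
        have hgP := (Finset.mem_filter.1 (Finset.mem_product.1 hg).1).2
        have hgP' := (Finset.mem_filter.1 (Finset.mem_product.1 hg').1).2
        have h : ∀ i, g i + c = g' i + c' := congrFun heq
        have hcc : c = c' := (existsUnique_sub_mem_parkingFunctions hk rfl fun i => g i + c).unique
          (by simpa using hgP) (by simpa [h] using hgP')
        subst hcc
        exact Prod.ext (funext fun i => add_right_cancel (h i)) rfl
      · intro g _
        obtain ⟨c, hc, -⟩ := existsUnique_sub_mem_parkingFunctions hk rfl g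
        exact ⟨(fun i => g i - c, c), by simpa [P] using hc, by simp⟩
    rw [Finset.card_product, Finset.card_univ, ZMod.card, Finset.card_univ, Fintype.card_fun,
      ZMod.card, Fintype.card_fin] at h1
    exact h1
  rw [hP]
  refine Nat.eq_of_mul_eq_mul_right (Nat.succ_pos (k * n)) ?_
  rw [Nat.succ_eq_add_one, hmul, ← pow_succ, Nat.sub_add_cancel hn]

end Count

/-! ### Regions and sign patterns -/

section Regions

variable {n k : ℕ}

theorem sub_ne_of_mem_shiComplement {x : Fin n → ℝ} (hx : x ∈ shiComplement k n)
    {p : Fin n × Fin n × ℤ} (hp : p ∈ shiIndex k n) : x p.1 - x p.2.1 ≠ p.2.2 := fun h =>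
  hx.2 (Set.mem_iUnion₂.2 ⟨p, hp, hx.1, h⟩)

/-- Points of one region lie on the same side of every hyperplane. -/
theorem sub_lt_of_mem_connectedComponentIn {x y : Fin n → ℝ}
    (hx : x ∈ shiComplement k n) (hy : y ∈ connectedComponentIn (shiComplement k n) x)
    {p : Fin n × Fin n × ℤ} (hp : p ∈ shiIndex k n) :
    x p.1 - x p.2.1 < p.2.2 ↔ y p.1 - y p.2.1 < p.2.2 := by
  have hcont : ContinuousOn (fun w : Fin n → ℝ => w p.1 - w p.2.1)
      (connectedComponentIn (shiComplement k n) x) := by fun_prop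
  have hpre := isPreconnected_connectedComponentIn (F := shiComplement k n) (x := x)
  have hsub := connectedComponentIn_subset (shiComplement k n) x
  have hno : ∀ u ∈ connectedComponentIn (shiComplement k n) x,
      ∀ w ∈ connectedComponentIn (shiComplement k n) x,
      u p.1 - u p.2.1 < p.2.2 → w p.1 - w p.2.1 < p.2.2 := by
    intro u hu w hw hlt
    by_contra! hge
    obtain ⟨v, hv, hveq⟩ := hpre.intermediate_value hu hw hcont ⟨hlt.le, hge⟩
    exact sub_ne_of_mem_shiComplement (hsub hv) hp hveq
  have hxx := mem_connectedComponentIn hx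
  exact ⟨hno x hxx y hy, hno y hy x hxx⟩

/-- Points of the complement on the same side of every hyperplane lie in one region, as the
segment between them avoids the hyperplanes. -/
theorem mem_connectedComponentIn_of_sub_lt_iff {x y : Fin n → ℝ}
    (hx : x ∈ shiComplement k n) (hy : y ∈ shiComplement k n)
    (h : ∀ p ∈ shiIndex k n, x p.1 - x p.2.1 < p.2.2 ↔ y p.1 - y p.2.1 < p.2.2) :
    y ∈ connectedComponentIn (shiComplement k n) x := by
  refine (convex_segment x y).isPreconnected.subset_connectedComponentIn
    (left_mem_segment ℝ x y) ?_ (right_mem_segment ℝ x y)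
  rintro w ⟨s, t, hs, ht, hst, rfl⟩
  refine ⟨?_, fun hcon => ?_⟩
  · have h1 : ∑ i, x i = 0 := hx.1
    have h2 : ∑ i, y i = 0 := hy.1
    show ∑ i, (s • x + t • y) i = 0
    simp [Finset.sum_add_distrib, ← Finset.mul_sum, h1, h2]
  · obtain ⟨p, hp, -, heq⟩ := Set.mem_iUnion₂.1 hcon
    have hxp := sub_ne_of_mem_shiComplement hx hp
    have hyp := sub_ne_of_mem_shiComplement hy hp
    have hiff := h p hp
    simp only [Pi.add_apply, Pi.smul_apply, smul_eq_mul] at heq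
    have heq' : s * (x p.1 - x p.2.1 - p.2.2) + t * (y p.1 - y p.2.1 - p.2.2) = 0 := by
      linear_combination heq - (p.2.2 : ℝ) * hst
    rcases lt_or_gt_of_ne hxp with hlt | hlt
    · have hlt' := hiff.1 hlt
      rcases hs.eq_or_lt with rfl | hs
      · nlinarith
      · nlinarith
    · have hlt' : (p.2.2 : ℝ) < y p.1 - y p.2.1 :=
        lt_of_le_of_ne (not_lt.1 (hiff.not.1 hlt.not_gt)) hyp.symm
      rcases hs.eq_or_lt with rfl | hs
      · nlinarith
      · nlinarith

variable [NeZero n]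

/-- The side of `H_{ij}^l`, for `l > 0`, is the comparison of the affine extension at `i` and
at `j + n l`, which lies in the window of `i`. -/
theorem mem_window_of_pos {i j : Fin n} (hji : j < i) {l : ℤ} (h0 : 0 < l) (hl : l ≤ k) :
    (j : ℤ) + n * l ∈ window k n (i : ℕ) := by
  have hn : (0 : ℤ) < n := by have := NeZero.pos n; omega
  have hi := i.2
  have hji' : (j : ℕ) < i := hji
  rw [mem_window]
  constructor <;> nlinarith

/-- The side of `H_{ij}^l`, for `l ≤ 0`, is the comparison of the affine extension at `j` and
at `i - n l`, which lies in the window of `j`. -/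
theorem mem_window_of_nonpos {i j : Fin n} (hji : j < i) {l : ℤ} (h0 : l ≤ 0) (hl : -(k : ℤ) < l) :
    (i : ℤ) + n * -l ∈ window k n (j : ℕ) := by
  have hn : (0 : ℤ) < n := by have := NeZero.pos n; omega
  have hi := i.2
  have hji' : (j : ℕ) < i := hji
  rw [mem_window]
  constructor <;> nlinarith

/-- Conversely, an integer in the window of `i`, with residue different from `i`, comes from one
of the hyperplanes `H_{ij}^l`, up to the sign of `l` and the order of the two indices. -/
theorem ediv_of_mem_window {i : Fin n} {c : ℤ} (hc : c ∈ window k n (i : ℕ)) :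
    (residue n c < i → 0 < c / n ∧ c / n ≤ k) ∧ (i < residue n c → 0 ≤ c / n ∧ c / n < k) := by
  have hn : (0 : ℤ) < n := by have := NeZero.pos n; omega
  have hi := i.2
  have hr := (residue n c).2
  have hc' := residue_add_mul_ediv (n := n) c
  rw [mem_window] at hc
  refine ⟨fun h => ?_, fun h => ?_⟩
  · have h' : (residue n c : ℕ) < i := h
    constructor
    · by_contra! hcon; nlinarith
    · by_contra! hcon
      have : (k : ℤ) + 1 ≤ c / n := hcon
      nlinarith
  · have h' : (i : ℕ) < residue n c := h
    constructor
    · by_contra! hcon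
      have : c / n ≤ -1 := by omega
      nlinarith
    · by_contra! hcon; nlinarith

theorem mem_shiComplement_iff {x : Fin n → ℝ} :
    x ∈ shiComplement k n ↔ x ∈ V n ∧ Generic k x := by
  simp only [shiComplement, Set.mem_sdiff, Set.mem_iUnion, not_exists]
  refine and_congr_right fun hV => ⟨fun h => ?_, fun h => ?_⟩
  · suffices hres : ∀ i : Fin n, ∀ c ∈ window k n (i : ℕ), lift x (i : ℕ) ≠ lift x c by
      intro a c hc heq
      have ha := residue_add_mul_ediv (n := n) a
      refine hres (residue n a) (c + n * -(a / n)) ?_ ?_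
      · rw [mem_window] at hc ⊢
        constructor <;> linarith
      · rw [lift_add_mul, ← heq, lift_coe, lift]
        push_cast
        ring
    intro i c hc heq
    have hq := ediv_of_mem_window hc
    rw [lift_coe, lift] at heq
    rcases lt_trichotomy (residue n c) i with hlt | heq' | hlt
    · exact h (i, residue n c, c / n)
        ⟨hlt, by have := hq.1 hlt; constructor <;> dsimp only <;> omega⟩
        ⟨hV, by show x i - x (residue n c) = _; linarith⟩
    · have hn : (0 : ℤ) < n := by have := NeZero.pos n; omega
      have hc' := residue_add_mul_ediv (n := n) c
      rw [heq'] at heq hc'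
      have h0 : c / n = 0 := by
        have : ((c / n : ℤ) : ℝ) = 0 := by linarith
        exact_mod_cast this
      rw [h0] at hc'
      rw [mem_window] at hc
      linarith [hc.1]
    · exact h (residue n c, i, -(c / n)) ⟨hlt, by have := hq.2 hlt; constructor <;> simp <;> omega⟩
        ⟨hV, by show x (residue n c) - x i = _; push_cast; linarith⟩
  · rintro ⟨i, j, l⟩ ⟨hji, hl1, hl2⟩ ⟨-, heq⟩
    change x i - x j = l at heq
    rcases lt_or_ge 0 l with h0 | h0
    · refine h _ _ (mem_window_of_pos hji h0 hl2) ?_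
      rw [lift_coe, lift_coe_add_mul]
      linarith
    · refine h _ _ (mem_window_of_nonpos hji h0 hl1) ?_
      rw [lift_coe, lift_coe_add_mul]
      push_cast
      linarith

theorem fundamentalAlcove_nonempty (n : ℕ) [NeZero n] : (fundamentalAlcove n).Nonempty := by
  have hn : (0 : ℝ) < n := by exact_mod_cast NeZero.pos n
  let s : ℝ := ∑ i : Fin n, (i : ℝ) / n
  refine ⟨fun i => (i : ℝ) / n - s / n, ?_, fun i j hij => ?_⟩
  · show ∑ i : Fin n, ((i : ℝ) / n - s / n) = 0
    rw [Finset.sum_sub_distrib, Finset.sum_const, Finset.card_univ, Fintype.card_fin, nsmul_eq_mul,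
      mul_div_cancel₀ _ hn.ne']
    exact sub_self s
  · have h1 : ((i : ℕ) : ℝ) < (j : ℕ) := by exact_mod_cast hij
    have h2 : ((j : ℕ) : ℝ) < n := by exact_mod_cast j.2
    have h3 : (0 : ℝ) ≤ (i : ℕ) := Nat.cast_nonneg _
    have h4 := div_lt_div_of_pos_right h1 hn
    have h5 : ((j : ℕ) : ℝ) / n < 1 := (div_lt_one hn).2 h2
    have h6 : 0 ≤ ((i : ℕ) : ℝ) / n := by positivity
    constructor <;> linarith

/-- The separating hyperplanes of the region of `x`, in terms of `x` alone: as
`0 < y i - y j < 1` on the fundamental alcove, for `l > 0` the point `x` has to lie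
above `H_{ij}^l` and for `l ≤ 0` below it. -/
theorem mem_separating_iff {x : Fin n → ℝ} (hx : x ∈ shiComplement k n)
    {p : Fin n × Fin n × ℤ} :
    p ∈ separating k n (connectedComponentIn (shiComplement k n) x) ↔ p ∈ shiIndex k n ∧
      (0 < p.2.2 ∧ p.2.2 < x p.1 - x p.2.1 ∨ p.2.2 ≤ 0 ∧ x p.1 - x p.2.1 < p.2.2) := by
  refine and_congr_right fun hp => ?_
  obtain ⟨y₀, hy₀⟩ := fundamentalAlcove_nonempty n
  have hsub := connectedComponentIn_subset (shiComplement k n) x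
  have hxx := mem_connectedComponentIn hx
  have hA : ∀ y ∈ fundamentalAlcove n, 0 < y p.1 - y p.2.1 ∧ y p.1 - y p.2.1 < 1 := by
    intro y hy
    have := hy.2 _ _ hp.1
    constructor <;> linarith
  have hcast : 0 < p.2.2 → (1 : ℝ) ≤ p.2.2 := fun h => by exact_mod_cast h
  have hcast' : p.2.2 ≤ 0 → (p.2.2 : ℝ) ≤ 0 := fun h => by exact_mod_cast h
  constructor
  · rintro (⟨h1, h2⟩ | ⟨h1, h2⟩)
    · refine Or.inr ⟨?_, h1 x hxx⟩
      by_contra! h0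
      linarith [hcast h0, hA y₀ hy₀, h2 y₀ hy₀]
    · refine Or.inl ⟨?_, h1 x hxx⟩
      by_contra! h0
      linarith [hcast' h0, hA y₀ hy₀, h2 y₀ hy₀]
  · rintro (⟨h0, h⟩ | ⟨h0, h⟩)
    · refine Or.inr ⟨fun y hy => ?_, fun y hy => ?_⟩
      · have := (sub_lt_of_mem_connectedComponentIn hx hy hp).not.1 h.not_gt
        exact lt_of_le_of_ne (not_lt.1 this) (sub_ne_of_mem_shiComplement (hsub hy) hp).symm
      · linarith [hA y hy, hcast h0]
    · refine Or.inl ⟨fun y hy => ?_, fun y hy => ?_⟩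
      · exact (sub_lt_of_mem_connectedComponentIn hx hy hp).1 h
      · linarith [hA y hy, hcast' h0]

/-- The label of the region of `x` counts the smaller entries in the windows. -/
theorem label_connectedComponentIn {x : Fin n → ℝ} (hx : x ∈ shiComplement k n) (a : Fin n) :
    label k n (connectedComponentIn (shiComplement k n) x) a = belowCount k x (a : ℕ) := by
  classical
  set R := connectedComponentIn (shiComplement k n) x
  let W := (window k n (a : ℕ)).filter fun c => lift x c < lift x (a : ℕ)
  have hlt : ∀ c : ℤ, lift x c < lift x (a : ℕ) ↔ x (residue n c) + (c / n : ℤ) < x a := by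
    intro c; rw [lift_coe, lift]
  have hne : ∀ c ∈ W, residue n c ≠ a := by
    intro c hc heq
    simp only [W, Finset.mem_filter, hlt, heq, mem_window] at hc
    have h0 : ((c / n : ℤ) : ℝ) < 0 := by linarith [hc.2]
    have h1 : c / n < 0 := by exact_mod_cast h0
    have hn : (0 : ℤ) < n := by have := NeZero.pos n; omega
    have hc' := residue_add_mul_ediv (n := n) c
    rw [heq] at hc'
    nlinarith [hc.1.1]
  have h1 : {p | p ∈ separating k n R ∧ 0 < p.2.2 ∧ p.1 = a}.ncard =
      (W.filter fun c => residue n c < a).card := by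
    rw [← Set.ncard_coe_finset]
    refine Set.ncard_congr (fun p _ => (p.2.1 : ℤ) + n * p.2.2) ?_ ?_ ?_
    · rintro ⟨i, j, l⟩ ⟨hp, h0, hia⟩
      rw [mem_separating_iff hx] at hp
      obtain rfl : i = a := hia
      obtain ⟨⟨hji, hl1, hl2⟩, h⟩ := hp
      change 0 < l at h0
      have h := h.resolve_right fun h' => absurd h0 h'.1.not_gt
      have h' : (l : ℝ) < x i - x j := h.2
      refine Finset.mem_filter.2
        ⟨Finset.mem_filter.2 ⟨mem_window_of_pos hji h0 hl2, ?_⟩, ?_⟩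
      · change lift x ((j : ℕ) + n * l) < lift x (i : ℕ)
        rw [lift_coe, lift_coe_add_mul]
        linarith
      · change residue n ((j : ℕ) + n * l) < i
        rwa [residue_coe_add_mul]
    · rintro ⟨i, j, l⟩ ⟨i', j', l'⟩ hp hp' heq
      obtain rfl : i = a := hp.2.2
      obtain rfl : i' = i := hp'.2.2
      have hj := congrArg (residue n) heq
      simp only [residue_coe_add_mul] at hj
      subst hj
      simpa [NeZero.ne n] using heq
    · intro c hc
      rw [Finset.mem_coe, Finset.mem_filter] at hc
      obtain ⟨hcW, hca⟩ := hc
      simp only [W, Finset.mem_filter, hlt] at hcW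
      have hq := (ediv_of_mem_window hcW.1).1 hca
      refine ⟨(a, residue n c, c / n), ⟨(mem_separating_iff hx).2 ⟨⟨hca, ?_, hq.2⟩,
        Or.inl ⟨hq.1, ?_⟩⟩, hq.1, rfl⟩, residue_add_mul_ediv c⟩
      · show -(k : ℤ) < c / n
        omega
      · show ((c / n : ℤ) : ℝ) < x a - x (residue n c)
        linarith [hcW.2]
  have h2 : {p | p ∈ separating k n R ∧ p.2.2 ≤ 0 ∧ p.2.1 = a}.ncard =
      (W.filter fun c => ¬ residue n c < a).card := by
    rw [← Set.ncard_coe_finset]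
    refine Set.ncard_congr (fun p _ => (p.1 : ℤ) + n * -p.2.2) ?_ ?_ ?_
    · rintro ⟨i, j, l⟩ ⟨hp, h0, hja⟩
      rw [mem_separating_iff hx] at hp
      obtain rfl : j = a := hja
      obtain ⟨⟨hji, hl1, hl2⟩, h⟩ := hp
      change l ≤ 0 at h0
      have h := h.resolve_left fun h' => absurd h0 h'.1.not_ge
      have h' : x i - x j < l := h.2
      refine Finset.mem_filter.2
        ⟨Finset.mem_filter.2 ⟨mem_window_of_nonpos hji h0 hl1, ?_⟩, ?_⟩
      · change lift x ((i : ℕ) + n * -l) < lift x (j : ℕ)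
        rw [lift_coe, lift_coe_add_mul]
        push_cast
        linarith
      · change ¬ residue n ((i : ℕ) + n * -l) < j
        rw [residue_coe_add_mul]
        exact not_lt.2 (le_of_lt hji)
    · rintro ⟨i, j, l⟩ ⟨i', j', l'⟩ hp hp' heq
      obtain rfl : j = a := hp.2.2
      obtain rfl : j' = j := hp'.2.2
      have hj := congrArg (residue n) heq
      simp only [residue_coe_add_mul] at hj
      subst hj
      simpa [NeZero.ne n] using heq
    · intro c hc
      rw [Finset.mem_coe, Finset.mem_filter] at hc
      obtain ⟨hcW, hca⟩ := hc
      have hac : a < residue n c := lt_of_le_of_ne (not_lt.1 hca) (hne c hcW).symm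
      simp only [W, Finset.mem_filter, hlt] at hcW
      have hq := (ediv_of_mem_window hcW.1).2 hac
      have h0 : -(c / n : ℤ) ≤ 0 := by omega
      refine ⟨(residue n c, a, -(c / n)), ⟨(mem_separating_iff hx).2 ⟨⟨hac, ?_, ?_⟩,
        Or.inr ⟨h0, ?_⟩⟩, h0, rfl⟩, ?_⟩
      · show -(k : ℤ) < -(c / n)
        omega
      · show -(c / n : ℤ) ≤ k
        omega
      · show x (residue n c) - x a < ((-(c / n) : ℤ) : ℝ)
        push_cast
        linarith [hcW.2]
      · show ((residue n c : ℕ) : ℤ) + n * - -(c / n) = c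
        rw [neg_neg]
        exact residue_add_mul_ediv c
  rw [label, h1, h2, Finset.card_filter_add_card_filter_not]
  rfl

/-- A set of indices has to contain a small value: the one where the coordinate is least, as no
residue in the set contributes to the count there. -/
theorem belowCount_mem_parkingFunctions (x : Fin n → ℝ) :
    (fun i : Fin n => belowCount k x (i : ℕ)) ∈ parkingFunctions k n := by
  classical
  intro I hI
  obtain ⟨i, hi, hmin⟩ := I.exists_min_image x hI
  refine ⟨i, hi, ?_⟩
  have hcard : n - I.card = Iᶜ.card := by rw [Finset.card_compl, Fintype.card_fin]
  rw [hcard, ← card_window_filter_residue_mem k ((i : ℕ) : ℤ)]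
  refine Finset.card_le_card fun c hc => ?_
  rw [Finset.mem_filter] at hc ⊢
  refine ⟨hc.1, Finset.mem_compl.2 fun hcI => ?_⟩
  have h1 := hmin _ hcI
  have hn : (0 : ℤ) < n := by have := NeZero.pos n; omega
  have h2 : 0 ≤ c / n := Int.ediv_nonneg (by have := (mem_window.1 hc.1).1; omega) hn.le
  have h3 : (0 : ℝ) ≤ (c / n : ℤ) := by exact_mod_cast h2
  have h4 := hc.2
  rw [lift_coe, lift] at h4
  linarith

theorem bijOn_label (hk : 0 < k) :
    Set.BijOn (label k n) (regions k n) (parkingFunctions k n) := by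
  refine ⟨?_, ?_, ?_⟩
  · rintro _ ⟨x, hx, rfl⟩
    rw [show label k n _ = _ from funext (label_connectedComponentIn hx)]
    exact belowCount_mem_parkingFunctions x
  · rintro _ ⟨x, hx, rfl⟩ _ ⟨y, hy, rfl⟩ heq
    have hb : ∀ a, belowCount k x a = belowCount k y a := fun a => by
      have := congrFun heq (residue n a)
      rwa [label_connectedComponentIn hx, label_connectedComponentIn hy, belowCount_residue,
        belowCount_residue] at this
    have hxg := (mem_shiComplement_iff.1 hx).2
    have hyg := (mem_shiComplement_iff.1 hy).2
    refine connectedComponentIn_eq (mem_connectedComponentIn_of_sub_lt_iff hx hy ?_)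
    rintro ⟨i, j, l⟩ ⟨hji, hl1, hl2⟩
    rcases lt_or_ge 0 l with h0 | h0
    · have hw := mem_window_of_pos hji h0 hl2
      have hiff := lift_lt_iff_of_belowCount_eq hxg hyg hb hw
      have hx' := hxg _ _ hw
      have hy' := hyg _ _ hw
      simp only [lift_coe, lift_coe_add_mul] at hiff hx' hy'
      show x i - x j < l ↔ y i - y j < l
      rw [sub_lt_iff_lt_add', sub_lt_iff_lt_add', ← not_le, ← not_le (b := y i),
        hx'.symm.le_iff_lt, hy'.symm.le_iff_lt, hiff]
    · have hiff := lift_lt_iff_of_belowCount_eq hxg hyg hb (mem_window_of_nonpos hji h0 hl1)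
      simp only [lift_coe, lift_coe_add_mul, Int.cast_neg] at hiff
      show x i - x j < l ↔ y i - y j < l
      constructor <;> intro h
      · linarith [hiff.1 (by linarith)]
      · linarith [hiff.2 (by linarith)]
  · intro f hf
    obtain ⟨x, hxg, hxf⟩ := exists_generic_belowCount_eq hk hf
    have hn : (n : ℝ) ≠ 0 := by exact_mod_cast NeZero.ne n
    -- a translate of `x` lies in `V`
    let s : ℝ := (∑ i, x i) / n
    let y : Fin n → ℝ := fun i => x i - s
    have hlift : ∀ c, lift y c = lift x c - s := fun c => by simp only [lift, y]; ring
    have hyV : y ∈ V n := by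
      show ∑ i, (x i - s) = 0
      rw [Finset.sum_sub_distrib, Finset.sum_const, Finset.card_univ, Fintype.card_fin,
        nsmul_eq_mul, mul_div_cancel₀ _ hn, sub_self]
    have hy : y ∈ shiComplement k n := mem_shiComplement_iff.2 ⟨hyV, fun a c hc h => by
      rw [hlift, hlift] at h
      exact hxg a c hc (sub_left_injective h)⟩
    refine ⟨_, ⟨y, hy, rfl⟩, funext fun a => ?_⟩
    have hyx : belowCount k y (a : ℕ) = belowCount k x (a : ℕ) := by
      simp only [belowCount, hlift, sub_lt_sub_iff_right]
    rw [label_connectedComponentIn hy, hyx, hxf, residue_coe]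

end Regions

end PakStanley

theorem mainTheorem3 (k n : ℕ) (hk : 1 ≤ k) (hn : 1 ≤ n) :
    Set.BijOn (PakStanley.label k n) (PakStanley.regions k n) (PakStanley.parkingFunctions k n) ∧
      (PakStanley.regions k n).ncard = (k * n + 1) ^ (n - 1) ∧
      (PakStanley.parkingFunctions k n).ncard = (k * n + 1) ^ (n - 1) := by
  have : NeZero n := ⟨by omega⟩
  have hbij := PakStanley.bijOn_label (n := n) hk
  have hcount := PakStanley.ncard_parkingFunctions (n := n) hk hn
  refine ⟨hbij, ?_, hcount⟩
  rw [← hcount, ← hbij.image_eq, hbij.injOn.ncard_image]
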